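/- Let $E$ be a real Banach lattice, with positive cone $E^+$. A sequence $(x_n)$ in $E$ is called $uaw$-null (unbounded absolutely weakly null) if $|x_n|\wedge u\to 0$ weakly for every $u\in E^+$. Then the following are equivalent: 1. The lattice operations of $E$ are sequentially weakly continuous, i.e. whenever $x_n\to x$ and $y_n\to y$ weakly in $E$, one has $x_n\vee y_n\to x\vee y$, $x_n\wedge y_n\to x\wedge y$, $|x_n|\to|x|$, $x_n^+\to x^+$ and $x_n^-\to x^-$ weakly. 2. Every sequence in $E$ that converges weakly to $0$ is $uaw$-null. -/

import Mathlib

open Filter Topology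

/-- The net `x` (indexed along the filter `l`) converges to `y` in the weak topology
`σ(E, E')` of the normed space `E`. -/
def WeakTendsto {ι E : Type*} [NormedAddCommGroup E] [NormedSpace ℝ E]
    (x : ι → E) (l : Filter ι) (y : E) : Prop :=
  Tendsto (fun i => toWeakSpace ℝ E (x i)) l (𝓝 (toWeakSpace ℝ E y))

/-- The net `x` is unbounded absolutely weakly convergent (`uaw`-convergent) to `y`:
for every `u ∈ E⁺` the net `|x i - y| ∧ u` converges weakly to `0`. -/
def UawTendsto {ι E : Type*} [NormedAddCommGroup E] [NormedSpace ℝ E] [Lattice E]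
    (x : ι → E) (l : Filter ι) (y : E) : Prop :=
  ∀ u : E, 0 ≤ u → WeakTendsto (fun i => |x i - y| ⊓ u) l 0

/-- The lattice operations `(x, y) ↦ x ∨ y`, `(x, y) ↦ x ∧ y`, `x ↦ |x|`, `x ↦ x⁺` and `x ↦ x⁻`
of `E` are sequentially continuous for the weak topology on `E` (and the product of the weak
topologies on `E × E`). -/
structure LatticeOpsSeqWeakContinuous (E : Type*) [NormedAddCommGroup E] [NormedSpace ℝ E]
    [Lattice E] : Prop where
  sup : ∀ (x y : ℕ → E) (a b : E), WeakTendsto x atTop a → WeakTendsto y atTop b →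
    WeakTendsto (fun n => x n ⊔ y n) atTop (a ⊔ b)
  inf : ∀ (x y : ℕ → E) (a b : E), WeakTendsto x atTop a → WeakTendsto y atTop b →
    WeakTendsto (fun n => x n ⊓ y n) atTop (a ⊓ b)
  abs : ∀ (x : ℕ → E) (a : E), WeakTendsto x atTop a → WeakTendsto (fun n => |x n|) atTop |a|
  posPart : ∀ (x : ℕ → E) (a : E), WeakTendsto x atTop a → WeakTendsto (fun n => (x n)⁺) atTop a⁺
  negPart : ∀ (x : ℕ → E) (a : E), WeakTendsto x atTop a → WeakTendsto (fun n => (x n)⁻) atTop a⁻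

/-! The substance is that if weakly null sequences are uaw-null, then `f |x n| → 0` for every weakly
null `x` and positive `f`. Applied to `x` and `-x`, it suffices to treat `f (x n)⁺`. If these values
stay above `5 * δ` on a subsequence, the hypothesis makes each late term almost disjoint, as seen by
`f`, from any fixed multiple of the earlier ones. Trimming gives disjoint `w k ≤ (x k)⁺` with `f (w
k) ≥ 3 * δ` (`exists_disjoint_pieces`). The components of `f` on the bands of the `w k` are positive
functionals with all partial sums below `f`, large at `x k` and small on earlier terms
(`exists_disjoint_functionals`). Summing a sparse subfamily gives a functional that is at least `δ`
along a subsequence of `x` (`false_of_gliding_hump`), against weak nullity. -/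

/-! ### Disjointness and decomposition in lattice-ordered groups. -/

section LatticeGroup

variable {E : Type*} [AddCommGroup E] [Lattice E] [IsOrderedAddMonoid E]

theorem add_inf_le_inf_add_inf {a b c : E} (ha : 0 ≤ a) (hb : 0 ≤ b) (hc : 0 ≤ c) :
    (a + b) ⊓ c ≤ a ⊓ c + b ⊓ c := by
  rw [add_inf, inf_add, inf_add]
  refine le_inf (le_inf inf_le_left ?_) (le_inf ?_ ?_)
  · exact inf_le_right.trans (le_add_of_nonneg_right hb)
  · exact inf_le_right.trans (le_add_of_nonneg_left ha)
  · exact inf_le_right.trans (le_add_of_nonneg_left hc)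

theorem inf_add_inf_le_add_inf_add (a b c d : E) : a ⊓ c + b ⊓ d ≤ (a + b) ⊓ (c + d) :=
  le_inf (add_le_add inf_le_left inf_le_left) (add_le_add inf_le_right inf_le_right)

theorem sub_posPart_add_inf (a b : E) : (a - b)⁺ + a ⊓ b = a := by
  rw [inf_eq_sub_posPart_sub]; abel

theorem posPart_sub_inf_posPart_sub (a b : E) : (a - b)⁺ ⊓ (b - a)⁺ = 0 := by
  have := posPart_inf_negPart_eq_zero (a - b)
  rwa [← posPart_neg, neg_sub] at this

theorem inf_eq_zero_of_le {E : Type*} [Lattice E] [Zero E] {a b c d : E} (ha : 0 ≤ a) (hb : 0 ≤ b) (hac : a ≤ c) (hbd : b ≤ d)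
    (h : c ⊓ d = 0) : a ⊓ b = 0 :=
  le_antisymm (h ▸ inf_le_inf hac hbd) (le_inf ha hb)

theorem inf_nsmul_eq_zero {a b : E} (ha : 0 ≤ a) (hb : 0 ≤ b) (h : a ⊓ b = 0) (m : ℕ) :
    a ⊓ m • b = 0 := by
  induction m with
  | zero => simpa using ha
  | succ m ih =>
    have hm : 0 ≤ m • b := nsmul_nonneg hb m
    refine le_antisymm ?_ (le_inf ha (nsmul_nonneg hb _))
    rw [succ_nsmul, inf_comm]
    refine (add_inf_le_inf_add_inf hm hb ha).trans ?_
    rw [inf_comm, ih, inf_comm, h, add_zero]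

theorem inf_sum_eq_zero {ι : Type*} {a : E} {v : ι → E} (s : Finset ι) (ha : 0 ≤ a)
    (hv : ∀ i, 0 ≤ v i) (h : ∀ i ∈ s, a ⊓ v i = 0) : a ⊓ ∑ i ∈ s, v i = 0 := by
  classical
  induction s using Finset.induction_on with
  | empty => simpa using ha
  | insert i s hi ih =>
    have hs : 0 ≤ ∑ i ∈ s, v i := Finset.sum_nonneg fun i _ => hv i
    rw [Finset.sum_insert hi]
    refine le_antisymm ?_ (le_inf ha (add_nonneg (hv i) hs))
    rw [inf_comm]
    refine (add_inf_le_inf_add_inf (hv i) hs ha).trans ?_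
    rw [inf_comm, h i (by simp), inf_comm, ih fun j hj => h j (by simp [hj]), add_zero]

/-- For disjoint elements the sum is the supremum, by `a ⊓ b + a ⊔ b = a + b`. -/
theorem sum_le_of_pairwise_inf_eq_zero {ι : Type*} {z : E} {v : ι → E} (s : Finset ι)
    (hz : 0 ≤ z) (hv : ∀ i, 0 ≤ v i) (hvz : ∀ i, v i ≤ z) (h : Pairwise fun i j => v i ⊓ v j = 0) :
    ∑ i ∈ s, v i ≤ z := by
  classical
  induction s using Finset.induction_on with
  | empty => simpa using hz
  | insert i s hi ih =>
    rw [Finset.sum_insert hi, ← inf_add_sup, inf_sum_eq_zero s (hv i) hv, zero_add]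
    · exact sup_le (hvz i) ih
    · rintro j hj
      exact h (by rintro rfl; exact hi hj)

/-- The excess of `b` over `a` is `(b - a)⁺`, which is disjoint from every multiple of `(a - b)⁺`.
The bound is uniform in `m`, so it passes to band components. -/
theorem inf_nsmul_posPart_sub_le {a : E} (ha : 0 ≤ a) (b : E) (m : ℕ) :
    b ⊓ m • (a - b)⁺ ≤ a := by
  have hw : 0 ≤ m • (a - b)⁺ := nsmul_nonneg (posPart_nonneg _) m
  calc b ⊓ m • (a - b)⁺ ≤ (a + (b - a)⁺) ⊓ m • (a - b)⁺ :=
        inf_le_inf_right _ (sub_le_iff_le_add'.1 (le_posPart _))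
    _ ≤ a ⊓ m • (a - b)⁺ + (b - a)⁺ ⊓ m • (a - b)⁺ :=
        add_inf_le_inf_add_inf ha (posPart_nonneg _) hw
    _ ≤ a + 0 := add_le_add inf_le_left (inf_nsmul_eq_zero (posPart_nonneg _) (posPart_nonneg _)
        (posPart_sub_inf_posPart_sub _ _) m).le
    _ = a := add_zero a

/-- Riesz decomposition: `y₁` is `y` truncated to the interval from `-a` to `a`. -/
theorem exists_add_eq_of_abs_le_add {y a b : E} (ha : 0 ≤ a) (hb : 0 ≤ b) (h : |y| ≤ a + b) :
    ∃ y₁ y₂, |y₁| ≤ a ∧ |y₂| ≤ b ∧ y₁ + y₂ = y := by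
  have h1 : y ≤ a + b := (le_abs_self y).trans h
  have h2 : -y ≤ a + b := (neg_le_abs y).trans h
  refine ⟨(y ⊓ a) ⊔ -a, y - (y ⊓ a) ⊔ -a, abs_le'.2 ⟨?_, ?_⟩, abs_le'.2 ⟨?_, ?_⟩, by abel⟩
  · exact sup_le inf_le_right (neg_le_self ha)
  · exact neg_le.1 le_sup_right
  · have : y - b ≤ y ⊓ a := le_inf (sub_le_self _ hb) (sub_le_iff_le_add.2 h1)
    exact sub_le_comm.1 (this.trans le_sup_left)
  · rw [neg_sub, sub_le_iff_le_add]
    refine sup_le (inf_le_left.trans (le_add_of_nonneg_left hb)) ?_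
    rw [neg_le_iff_add_nonneg]
    have := neg_le_iff_add_nonneg.1 h2
    convert this using 1
    abel

theorem abs_sup_sub_sup_le_add (a b c d : E) : |a ⊔ b - c ⊔ d| ≤ |a - c| + |b - d| := by
  have h := (abs_add_le (a ⊔ b - c ⊔ b) (c ⊔ b - c ⊔ d)).trans
    (add_le_add (abs_sup_sub_sup_le_abs a c b) (by
      simpa only [sup_comm c] using abs_sup_sub_sup_le_abs b d c))
  simpa using h

end LatticeGroup

/-! ### Weak convergence and positive functionals. -/

theorem weakTendsto_iff {ι E : Type*} [NormedAddCommGroup E] [NormedSpace ℝ E]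
    {x : ι → E} {l : Filter ι} {y : E} :
    WeakTendsto x l y ↔ ∀ f : E →L[ℝ] ℝ, Tendsto (fun i => f (x i)) l (𝓝 (f y)) := by
  unfold WeakTendsto
  refine Iff.trans (WeakBilin.tendsto_iff_forall_eval_tendsto
    (B := (topDualPairing ℝ E).flip) ?_) Iff.rfl
  intro a b hab
  exact (SeparatingDual.eq_iff_forall_dual_eq (R := ℝ)).2 fun g => congrArg (fun F => F g) hab

theorem WeakTendsto.exists_norm_le {E : Type*} [NormedAddCommGroup E] [NormedSpace ℝ E]
    {x : ℕ → E} {y : E} (hx : WeakTendsto x atTop y) : ∃ M, ∀ n, ‖x n‖ ≤ M := by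
  obtain ⟨M, hM⟩ := banach_steinhaus (g := fun n => NormedSpace.inclusionInDoubleDual ℝ E (x n))
    fun f => by
      obtain ⟨C, hC⟩ := (weakTendsto_iff.1 hx f).norm.bddAbove_range
      exact ⟨C, fun n => hC ⟨n, rfl⟩⟩
  refine ⟨M, fun n => ?_⟩
  rw [← (NormedSpace.inclusionInDoubleDualLi (E := E) ℝ).norm_map (x n)]
  exact hM n

theorem norm_le_norm_of_nonneg_of_le {E : Type*} [NormedAddCommGroup E] [Lattice E]
    [IsOrderedAddMonoid E] [HasSolidNorm E] {a b : E} (ha : 0 ≤ a) (hab : a ≤ b) : ‖a‖ ≤ ‖b‖ :=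
  norm_le_norm_of_abs_le_abs (by rwa [abs_of_nonneg ha, abs_of_nonneg (ha.trans hab)])

theorem map_le_map_of_nonneg {E : Type*} [NormedAddCommGroup E] [NormedSpace ℝ E]
    [Lattice E] [IsOrderedAddMonoid E] {f : E →L[ℝ] ℝ} (hf : ∀ z, 0 ≤ z → 0 ≤ f z) {a b : E}
    (hab : a ≤ b) : f a ≤ f b := by
  simpa using hf _ (sub_nonneg.2 hab)

theorem abs_map_le_map_abs {E : Type*} [NormedAddCommGroup E] [NormedSpace ℝ E]
    [Lattice E] [IsOrderedAddMonoid E] {f : E →L[ℝ] ℝ} (hf : ∀ z, 0 ≤ z → 0 ≤ f z) (z : E) :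
    |f z| ≤ f |z| :=
  abs_le'.2 ⟨map_le_map_of_nonneg hf (le_abs_self z), by
    rw [← map_neg]; exact map_le_map_of_nonneg hf (neg_le_abs z)⟩

section NormedLattice

variable {E : Type*} [NormedAddCommGroup E] [NormedSpace ℝ E] [Lattice E] [IsOrderedAddMonoid E]
  [HasSolidNorm E]

/-- An additive functional on the positive cone that is dominated by a multiple of the norm
extends to a continuous linear functional. -/
theorem exists_clm_eq_of_nonneg {p : E → ℝ} {C : ℝ} (h0 : ∀ z, 0 ≤ z → 0 ≤ p z)
    (hadd : ∀ a b, 0 ≤ a → 0 ≤ b → p (a + b) = p a + p b) (hC : ∀ z, 0 ≤ z → p z ≤ C * ‖z‖) :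
    ∃ g : E →L[ℝ] ℝ, ∀ z, 0 ≤ z → g z = p z := by
  have hp0 : p 0 = 0 := by simpa using hadd 0 0 le_rfl le_rfl
  let T : E →+ ℝ := AddMonoidHom.mk' (fun z => p z⁺ - p z⁻) fun a b => by
    -- Rearranged so that both sides are sums of positive elements, where `p` is additive.
    have h1 : (a + b)⁺ + (a⁻ + b⁻) = (a + b)⁻ + (a⁺ + b⁺) := by
      have h : (a + b)⁺ + (a⁻ + b⁻) - ((a + b)⁻ + (a⁺ + b⁺)) =
          ((a + b)⁺ - (a + b)⁻) - (a⁺ - a⁻) - (b⁺ - b⁻) := by abel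
      rw [← sub_eq_zero, h]
      simp only [posPart_sub_negPart]
      abel
    have h2 := congrArg p h1
    have n := fun z : E => posPart_nonneg z
    have n' := fun z : E => negPart_nonneg z
    rw [hadd _ _ (n _) (add_nonneg (n' _) (n' _)), hadd _ _ (n' _) (n' _),
      hadd _ _ (n' _) (add_nonneg (n _) (n _)), hadd _ _ (n _) (n _)] at h2
    linarith
  have hT : ∀ z, ‖T z‖ ≤ C * ‖z‖ := fun z => by
    have h1 := hadd _ _ (posPart_nonneg z) (negPart_nonneg z)
    rw [posPart_add_negPart] at h1
    have h2 := hC |z| (abs_nonneg z)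
    rw [norm_abs_eq_norm] at h2
    have h3 := h0 _ (posPart_nonneg z)
    have h4 := h0 _ (negPart_nonneg z)
    rw [Real.norm_eq_abs]
    exact abs_le.2 ⟨by change _ ≤ p z⁺ - p z⁻; linarith, by change p z⁺ - p z⁻ ≤ _; linarith⟩
  refine ⟨T.toRealLinearMap (AddMonoidHomClass.continuous_of_bound T C hT), fun z hz => ?_⟩
  change p z⁺ - p z⁻ = p z
  rw [posPart_of_nonneg hz, negPart_of_nonneg hz, hp0, sub_zero]

/-- Every continuous functional on a normed lattice has a positive majorant. -/
theorem exists_nonneg_clm_abs_le (f : E →L[ℝ] ℝ) :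
    ∃ g : E →L[ℝ] ℝ, (∀ z, 0 ≤ z → 0 ≤ g z) ∧ ∀ y, |f y| ≤ g |y| := by
  -- The Riesz–Kantorovich formula for the modulus of `f` on the positive cone.
  let p : E → ℝ := fun z => sSup (f '' {y | |y| ≤ z})
  have hb : ∀ z y, |y| ≤ z → f y ≤ ‖f‖ * ‖z‖ := fun z y hy =>
    (le_abs_self _).trans <| (f.le_opNorm y).trans <| by
      gcongr
      rw [← norm_abs_eq_norm]
      exact norm_le_norm_of_nonneg_of_le (abs_nonneg y) hy
  have hbdd : ∀ z, BddAbove (f '' {y | |y| ≤ z}) := fun z =>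
    ⟨‖f‖ * ‖z‖, by rintro _ ⟨y, hy, rfl⟩; exact hb z y hy⟩
  have hle : ∀ z y, |y| ≤ z → f y ≤ p z := fun z y hy => le_csSup (hbdd z) ⟨y, hy, rfl⟩
  have hne : ∀ z : E, 0 ≤ z → (f '' {y | |y| ≤ z}).Nonempty := fun z hz =>
    ⟨f 0, 0, by simpa using hz, rfl⟩
  have h0 : ∀ z, 0 ≤ z → 0 ≤ p z := fun z hz => by
    simpa using hle z 0 (by simpa using hz)
  obtain ⟨g, hg⟩ := exists_clm_eq_of_nonneg (p := p) (C := ‖f‖) h0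
    (fun a b ha hb => by
      apply le_antisymm
      · refine csSup_le (hne _ (add_nonneg ha hb)) ?_
        rintro _ ⟨y, hy, rfl⟩
        obtain ⟨y₁, y₂, h1, h2, rfl⟩ := exists_add_eq_of_abs_le_add ha hb hy
        rw [map_add]
        exact add_le_add (hle _ _ h1) (hle _ _ h2)
      · rw [← le_sub_iff_add_le]
        refine csSup_le (hne _ ha) ?_
        rintro _ ⟨y₁, h1, rfl⟩
        rw [le_sub_comm]
        refine csSup_le (hne _ hb) ?_
        rintro _ ⟨y₂, h2, rfl⟩
        rw [le_sub_iff_add_le, add_comm, ← map_add]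
        exact hle _ _ ((abs_add_le _ _).trans (add_le_add h1 h2)))
    (fun z hz => csSup_le (hne z hz) (by rintro _ ⟨y, hy, rfl⟩; exact hb z y hy))
  refine ⟨g, fun z hz => (hg z hz).symm ▸ h0 z hz, fun y => ?_⟩
  rw [hg _ (abs_nonneg y)]
  refine abs_le'.2 ⟨hle _ _ le_rfl, ?_⟩
  rw [← map_neg]
  exact hle _ _ (abs_neg y).le

/-- The component of a positive functional `f` carried by the band generated by `w ≥ 0`. -/
theorem exists_band_component {f : E →L[ℝ] ℝ} (hf : ∀ z, 0 ≤ z → 0 ≤ f z) {w : E} (hw : 0 ≤ w) :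
    ∃ g : E →L[ℝ] ℝ, ∀ z, 0 ≤ z → Tendsto (fun m : ℕ => f (z ⊓ m • w)) atTop (𝓝 (g z)) := by
  have hlim : ∀ z, 0 ≤ z →
      Tendsto (fun m : ℕ => f (z ⊓ m • w)) atTop (𝓝 (⨆ m : ℕ, f (z ⊓ m • w))) := fun z _ =>
    tendsto_atTop_ciSup
      (fun m n hmn => map_le_map_of_nonneg hf (inf_le_inf_left _ (nsmul_le_nsmul_left hw hmn)))
      ⟨f z, by rintro _ ⟨m, rfl⟩; exact map_le_map_of_nonneg hf inf_le_left⟩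
  have hm : ∀ m : ℕ, 0 ≤ m • w := nsmul_nonneg hw
  obtain ⟨g, hg⟩ := exists_clm_eq_of_nonneg (p := fun z => ⨆ m : ℕ, f (z ⊓ m • w)) (C := ‖f‖)
    (fun z hz => ge_of_tendsto' (hlim z hz) fun m => hf _ (le_inf hz (hm m)))
    (fun a b ha hb => by
      have hab := add_nonneg ha hb
      -- Superadditivity compares index `m` with `2 * m`, since `a ⊓ m • w + b ⊓ m • w ≤ (a + b) ⊓
      -- (2 * m) • w`.
      have h2 : Tendsto (fun m : ℕ => 2 * m) atTop atTop :=
        tendsto_id.const_mul_atTop' (by norm_num)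
      apply le_antisymm
      · refine le_of_tendsto_of_tendsto' (hlim _ hab) ((hlim a ha).add (hlim b hb)) fun m => ?_
        rw [← map_add]
        exact map_le_map_of_nonneg hf (add_inf_le_inf_add_inf ha hb (hm m))
      · refine le_of_tendsto_of_tendsto' ((hlim a ha).add (hlim b hb)) ((hlim _ hab).comp h2)
          fun m => ?_
        rw [← map_add]
        refine map_le_map_of_nonneg hf ((inf_add_inf_le_add_inf_add _ _ _ _).trans_eq ?_)
        simp only [two_mul, add_nsmul])
    (fun z hz => le_of_tendsto' (hlim z hz) fun m =>
      (map_le_map_of_nonneg hf inf_le_left).trans ((le_abs_self _).trans (f.le_opNorm z)))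
  exact ⟨g, fun z hz => (hg z hz).symm ▸ hlim z hz⟩

theorem weakTendsto_of_abs_sub_le {ι : Type*} {l : Filter ι} {x v : ι → E} {a : E}
    (hv : ∀ g : E →L[ℝ] ℝ, (∀ z, 0 ≤ z → 0 ≤ g z) → Tendsto (fun i => g (v i)) l (𝓝 0))
    (h : ∀ i, |x i - a| ≤ v i) : WeakTendsto x l a := by
  refine weakTendsto_iff.2 fun f => ?_
  obtain ⟨g, hg, hfg⟩ := exists_nonneg_clm_abs_le f
  rw [tendsto_iff_norm_sub_tendsto_zero]
  refine squeeze_zero (fun _ => norm_nonneg _) (fun i => ?_) (hv g hg)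
  rw [← map_sub]
  exact (hfg _).trans (map_le_map_of_nonneg hg (h i))

/-- The supremum is controlled by `|x n - a| + |y n - b|`; the other operations are suprema up to
sign changes. -/
theorem latticeOpsSeqWeakContinuous_of_abs
    (h : ∀ x : ℕ → E, WeakTendsto x atTop 0 → ∀ g : E →L[ℝ] ℝ, (∀ z, 0 ≤ z → 0 ≤ g z) →
      Tendsto (fun n => g |x n|) atTop (𝓝 0)) : LatticeOpsSeqWeakContinuous E := by
  have hsub : ∀ (x : ℕ → E) (a : E), WeakTendsto x atTop a →
      WeakTendsto (fun n => x n - a) atTop 0 := fun x a hx => weakTendsto_iff.2 fun f => by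
    simpa using (weakTendsto_iff.1 hx f).sub_const (f a)
  have hneg : ∀ (x : ℕ → E) (a : E), WeakTendsto x atTop a →
      WeakTendsto (fun n => -x n) atTop (-a) := fun x a hx => weakTendsto_iff.2 fun f => by
    simpa using (weakTendsto_iff.1 hx f).neg
  have hconst : ∀ a : E, WeakTendsto (fun _ : ℕ => a) atTop a := fun a => tendsto_const_nhds
  have hsup : ∀ (x y : ℕ → E) (a b : E), WeakTendsto x atTop a → WeakTendsto y atTop b →
      WeakTendsto (fun n => x n ⊔ y n) atTop (a ⊔ b) := fun x y a b hx hy =>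
    weakTendsto_of_abs_sub_le (v := fun n => |x n - a| + |y n - b|)
      (fun g hg => by simpa using (h _ (hsub x a hx) g hg).add (h _ (hsub y b hy) g hg))
      fun n => abs_sup_sub_sup_le_add _ _ _ _
  refine ⟨hsup, fun x y a b hx hy => ?_, fun x a hx => hsup _ _ _ _ hx (hneg x a hx),
    fun x a hx => hsup _ _ _ _ hx (hconst 0),
    fun x a hx => hsup _ _ _ _ (hneg x a hx) (hconst 0)⟩
  simpa [neg_sup] using hneg _ _ (hsup _ _ _ _ (hneg x a hx) (hneg y b hy))

end NormedLattice

/-! ### Passing to subsequences. -/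

theorem exists_strictMono_forall_succ {Q : ℕ → ℕ → Prop} (hQ : ∀ N, ∀ᶠ n in atTop, Q N n) :
    ∃ φ : ℕ → ℕ, StrictMono φ ∧ ∀ k, Q (φ k) (φ (k + 1)) := by
  choose next hlt hnext using fun N => ((eventually_gt_atTop N).and (hQ N)).exists
  exact ⟨fun k => Nat.rec 0 (fun _ N => next N) k, strictMono_nat_of_lt_succ fun k => hlt _,
    fun k => hnext _⟩

theorem WeakTendsto.comp_strictMono {E : Type*} [NormedAddCommGroup E] [NormedSpace ℝ E]
    {x : ℕ → E} {a : E} (hx : WeakTendsto x atTop a) {φ : ℕ → ℕ}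
    (hφ : StrictMono φ) : WeakTendsto (x ∘ φ) atTop a :=
  Tendsto.comp (f := φ) (g := fun n => toWeakSpace ℝ E (x n)) hx hφ.tendsto_atTop

/-! ### Disjoint pieces, their band functionals and the gliding hump. -/

section BanachLattice

variable {E : Type*} [NormedAddCommGroup E] [NormedSpace ℝ E] [Lattice E] [IsOrderedAddMonoid E]

/-- The second factor is `t` times `(t⁻¹ • b - a)⁺`, and this positive part is disjoint from the
first factor. A natural number above `t` reduces the scalar to `inf_nsmul_eq_zero`. -/
theorem posPart_sub_smul_inf_eq_zero [IsOrderedModule ℝ E] (a b : E) {t : ℝ} (ht : 0 < t) :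
    (a - t⁻¹ • b)⁺ ⊓ (b - t • a)⁺ = 0 := by
  obtain ⟨m, hm⟩ := exists_nat_ge t
  have hv : 0 ≤ (t⁻¹ • b - a)⁺ := posPart_nonneg _
  refine inf_eq_zero_of_le (posPart_nonneg _) (posPart_nonneg _) le_rfl ?_
    (inf_nsmul_eq_zero (posPart_nonneg _) hv (posPart_sub_inf_posPart_sub _ _) m)
  refine sup_le ?_ (nsmul_nonneg hv m)
  calc b - t • a = t • (t⁻¹ • b - a) := by rw [smul_sub, smul_inv_smul₀ ht.ne']
    _ ≤ t • (t⁻¹ • b - a)⁺ := smul_le_smul_of_nonneg_left (le_posPart _) ht.le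
    _ ≤ (m : ℝ) • (t⁻¹ • b - a)⁺ := smul_le_smul_of_nonneg_right hm hv
    _ = m • (t⁻¹ • b - a)⁺ := Nat.cast_smul_eq_nsmul ℝ m _

variable [HasSolidNorm E]

/-- In a bounded sequence `x` whose positive parts stay away from zero under `f ≥ 0` while
`f (|x n| ⊓ u) → 0` for all `u ≥ 0`, some subsequence has pairwise disjoint pieces `w k` below
the positive parts that still carry most of the `f`-mass. -/
theorem exists_disjoint_pieces [CompleteSpace E] [IsOrderedModule ℝ E]
    {f : E →L[ℝ] ℝ} (hf : ∀ z, 0 ≤ z → 0 ≤ f z) {x : ℕ → E}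
    {M δ K : ℝ} (hM : ∀ n, ‖x n‖ ≤ M) (hδ : 0 < δ) (hK : 0 < K) (hKM : ‖f‖ * (2 * M) ≤ K * δ)
    (hx : ∀ n, 5 * δ ≤ f (x n)⁺)
    (hux : ∀ u : E, 0 ≤ u → Tendsto (fun n => f (|x n| ⊓ u)) atTop (𝓝 0)) :
    ∃ φ : ℕ → ℕ, StrictMono φ ∧ ∃ w : ℕ → E, (∀ k, 0 ≤ w k) ∧ (∀ k, w k ≤ (x (φ k))⁺) ∧
      (Pairwise fun i j => w i ⊓ w j = 0) ∧ (∀ k, 3 * δ ≤ f (w k)) ∧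
      ∀ i j, i < j → w j ≤ ((x (φ j))⁺ - (K * 2 ^ j) • |x (φ i)|)⁺ := by
  -- One element dominating the required multiples of all terms up to index `N`; the extraction
  -- makes the next term meet it with `f`-mass at most `δ`.
  let B : ℕ → E := fun N => (K * 2 ^ (N + 1)) • ∑ i ∈ Finset.range (N + 1), |x i|
  have hB : ∀ N, 0 ≤ B N := fun N =>
    smul_nonneg (by positivity) (Finset.sum_nonneg fun i _ => abs_nonneg _)
  obtain ⟨φ, hφ, hφQ⟩ := exists_strictMono_forall_succ
    (Q := fun N n => f (|x n| ⊓ B N) ≤ δ) fun N => (hux _ (hB N)).eventually_le_const hδ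
  let y : ℕ → E := fun k => x (φ (k + 1))
  have hBy : ∀ i j, i < j → (K * 2 ^ j) • |y i| ≤ B (φ j) := fun i j hij => by
    have h1 : |y i| ≤ ∑ i ∈ Finset.range (φ j + 1), |x i| :=
      Finset.single_le_sum (f := fun i => |x i|) (fun i _ => abs_nonneg _)
        (Finset.mem_range.2 (Nat.lt_succ_of_le (hφ.monotone hij)))
    refine (smul_le_smul_of_nonneg_left h1 (by positivity)).trans
      (smul_le_smul_of_nonneg_right ?_ ((abs_nonneg _).trans h1))
    have : j ≤ φ j + 1 := (hφ.id_le j).trans (Nat.le_succ _)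
    gcongr
    norm_num
  -- Subtracting small multiples of all terms, later ones included, forces disjointness. The weights
  -- make the series converge, and `hKM` makes its `f`-mass at most `δ`.
  let d : ℕ → E := fun k => (K * 2 ^ k)⁻¹ • |y k|
  have hd : ∀ k, 0 ≤ d k := fun k => smul_nonneg (by positivity) (abs_nonneg _)
  have hdn : ∀ k, ‖d k‖ ≤ K⁻¹ * M * (1 / 2) ^ k := fun k => by
    have h2 : ‖(K * 2 ^ k)⁻¹‖ = K⁻¹ * (1 / 2) ^ k := by
      rw [Real.norm_of_nonneg (by positivity), mul_inv, one_div, inv_pow]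
    rw [norm_smul, norm_abs_eq_norm, h2, mul_right_comm]
    gcongr
    exact hM _
  have hgeo : HasSum (fun k : ℕ => K⁻¹ * M * (1 / 2 : ℝ) ^ k) (K⁻¹ * M * 2) :=
    hasSum_geometric_two.mul_left _
  have hds : Summable d := Summable.of_norm_bounded hgeo.summable hdn
  let D : E := ∑' k, d k
  have hD : 0 ≤ D := tsum_nonneg hd
  have hdD : ∀ k, d k ≤ D := fun k => hds.le_tsum k fun j _ => hd j
  have hfD : f D ≤ δ := by
    refine (le_abs_self _).trans ((f.le_opNorm D).trans ?_)
    have h1 : ‖D‖ ≤ K⁻¹ * M * 2 := tsum_of_norm_bounded hgeo hdn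
    calc ‖f‖ * ‖D‖ ≤ ‖f‖ * (K⁻¹ * M * 2) := by gcongr
      _ = K⁻¹ * (‖f‖ * (2 * M)) := by ring
      _ ≤ K⁻¹ * (K * δ) := by gcongr
      _ = δ := inv_mul_cancel_left₀ hK.ne' δ
  let w : ℕ → E := fun k => ((y k)⁺ - B (φ k) - D)⁺
  have hw : ∀ k, 0 ≤ w k := fun k => posPart_nonneg _
  have habs : ∀ k, (y k)⁺ ≤ |y k| := fun k => sup_le (le_abs_self _) (abs_nonneg _)
  have hw1 : ∀ i j, i < j → w j ≤ ((y j)⁺ - (K * 2 ^ j) • |y i|)⁺ := fun i j hij =>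
    posPart_mono ((sub_le_self _ hD).trans (sub_le_sub_left (hBy i j hij) _))
  have hw2 : ∀ i j, w i ≤ (|y i| - (K * 2 ^ j)⁻¹ • |y j|)⁺ := fun i j =>
    posPart_mono (sub_le_sub ((sub_le_self _ (hB _)).trans (habs i)) (hdD j))
  have hdisj : ∀ i j, i < j → w i ⊓ w j = 0 := fun i j hij =>
    inf_eq_zero_of_le (hw i) (hw j) (hw2 i j)
      ((hw1 i j hij).trans (posPart_mono (sub_le_sub_right (habs j) _)))
      (posPart_sub_smul_inf_eq_zero |y i| |y j| (by positivity))
  refine ⟨fun k => φ (k + 1), fun a b hab => hφ (Nat.succ_lt_succ hab), w, hw, fun k => ?_,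
    fun i j hij => ?_, fun k => ?_, hw1⟩
  · exact sup_le ((sub_le_self _ hD).trans (sub_le_self _ (hB _))) (posPart_nonneg _)
  · rcases lt_or_gt_of_ne hij with h | h
    · exact hdisj i j h
    · rw [inf_comm]
      exact hdisj j i h
  -- Removing `B (φ k)` and `D` costs at most `δ` each, so `5 * δ` drops to `3 * δ`.
  · have h1 : (y k)⁺ ≤ w k + D + (y k)⁺ ⊓ B (φ k) := by
      conv_lhs => rw [← sub_posPart_add_inf (y k)⁺ (B (φ k))]
      exact add_le_add_left (sup_le (sub_le_iff_le_add.1 (le_posPart _)) (add_nonneg (hw k) hD)) _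
    have h2 := map_le_map_of_nonneg hf h1
    rw [map_add, map_add] at h2
    have h3 : f ((y k)⁺ ⊓ B (φ k)) ≤ δ :=
      (map_le_map_of_nonneg hf (inf_le_inf_right _ (habs k))).trans (hφQ k)
    have h4 : 5 * δ ≤ f (y k)⁺ := hx _
    linarith

theorem exists_disjoint_functionals [IsOrderedModule ℝ E]
    {f : E →L[ℝ] ℝ} (hf : ∀ z, 0 ≤ z → 0 ≤ f z) {x w : ℕ → E}
    {M δ K : ℝ} (hM : ∀ n, ‖x n‖ ≤ M) (hK : 0 < K) (hKM : ‖f‖ * (2 * M) ≤ K * δ)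
    (hw : ∀ k, 0 ≤ w k) (hwx : ∀ k, w k ≤ (x k)⁺) (hdisj : Pairwise fun i j => w i ⊓ w j = 0)
    (hfw : ∀ k, 3 * δ ≤ f (w k))
    (hsmall : ∀ i j, i < j → w j ≤ ((x j)⁺ - (K * 2 ^ j) • |x i|)⁺) :
    ∃ F : ℕ → E →L[ℝ] ℝ, (∀ j z, 0 ≤ z → 0 ≤ F j z) ∧
      (∀ (s : Finset ℕ) z, 0 ≤ z → ∑ j ∈ s, F j z ≤ f z) ∧ (∀ j, 3 * δ ≤ F j (x j)) ∧
      ∀ i j, i < j → F j |x i| ≤ δ / 2 * (1 / 2) ^ j := by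
  -- `F j` is the component of `f` on the band of `w j`. It vanishes on `(x j)⁻`, which is disjoint
  -- from `w j`.
  choose F hF using fun j => exists_band_component hf (hw j)
  have hm : ∀ (m : ℕ) j, 0 ≤ m • w j := fun m j => nsmul_nonneg (hw j) m
  refine ⟨F, fun j z hz => ge_of_tendsto' (hF j z hz) fun m => hf _ (le_inf hz (hm m j)),
    fun s z hz => ?_, fun j => ?_, fun i j hij => ?_⟩
  · refine le_of_tendsto' (tendsto_finsetSum s fun j _ => hF j z hz) fun m => ?_
    rw [← map_sum]
    refine map_le_map_of_nonneg hf (sum_le_of_pairwise_inf_eq_zero s hz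
      (fun j => le_inf hz (hm m j)) (fun j => inf_le_left) fun i j hij => ?_)
    refine inf_eq_zero_of_le (le_inf hz (hm m i)) (le_inf hz (hm m j)) inf_le_right inf_le_right ?_
    refine inf_nsmul_eq_zero (hm m i) (hw j) ?_ m
    rw [inf_comm]
    exact inf_nsmul_eq_zero (hw j) (hw i) (hdisj hij.symm) m
  · have h1 : F j (x j)⁻ = 0 := by
      refine tendsto_nhds_unique (hF j _ (negPart_nonneg _)) ?_
      have h2 : (x j)⁻ ⊓ w j = 0 := by
        rw [inf_comm]
        exact inf_eq_zero_of_le (hw j) (negPart_nonneg _) (hwx j) le_rfl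
          (posPart_inf_negPart_eq_zero _)
      simp only [inf_nsmul_eq_zero (negPart_nonneg _) (hw j) h2, map_zero]
      exact tendsto_const_nhds
    have h3 : f (w j) ≤ F j (x j)⁺ := by
      refine ge_of_tendsto (hF j _ (posPart_nonneg _)) ?_
      filter_upwards [eventually_ge_atTop 1] with m hm1
      refine map_le_map_of_nonneg hf (le_inf (hwx j) ?_)
      simpa using nsmul_le_nsmul_left (hw j) hm1
    rw [← posPart_sub_negPart (x j), map_sub, h1, sub_zero]
    exact (hfw j).trans h3
  · have ht : 0 < K * 2 ^ j := by positivity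
    have hxi : 0 ≤ (K * 2 ^ j) • |x i| := smul_nonneg ht.le (abs_nonneg _)
    -- On the band of `w j`, the multiple of `|x i|` lies below `(x j)⁺`; dividing by `K * 2 ^ j`
    -- gives the geometric decay.
    have h1 : F j ((K * 2 ^ j) • |x i|) ≤ f (x j)⁺ := by
      refine le_of_tendsto' (hF j _ hxi) fun m => map_le_map_of_nonneg hf ?_
      exact (inf_le_inf_left _ (nsmul_le_nsmul_right (hsmall i j hij) m)).trans
        (inf_nsmul_posPart_sub_le (posPart_nonneg _) _ m)
    have h2 : f (x j)⁺ ≤ ‖f‖ * M := by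
      refine (le_abs_self _).trans ((f.le_opNorm _).trans ?_)
      gcongr
      refine le_trans ?_ (hM j)
      rw [← norm_abs_eq_norm (x j)]
      exact norm_le_norm_of_nonneg_of_le (posPart_nonneg _)
        (sup_le (le_abs_self _) (abs_nonneg _))
    rw [map_smul, smul_eq_mul] at h1
    have h3 : K * (2 ^ j * F j |x i|) ≤ K * (δ / 2) := by nlinarith
    have h4 := le_of_mul_le_mul_left h3 hK
    rw [one_div, inv_pow, ← div_eq_mul_inv, le_div_iff₀ (by positivity)]
    linarith

/-- Domination by `f` gives convergence on the positive cone, and differences of positive elements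
give the rest. -/
theorem exists_hasSum_clm {f : E →L[ℝ] ℝ} {G : ℕ → E →L[ℝ] ℝ}
    (hG : ∀ j z, 0 ≤ z → 0 ≤ G j z) (hGf : ∀ (s : Finset ℕ) z, 0 ≤ z → ∑ j ∈ s, G j z ≤ f z) :
    ∃ g : E →L[ℝ] ℝ, ∀ z, HasSum (fun j => G j z) (g z) := by
  have hs : ∀ z, 0 ≤ z → Summable fun j => G j z := fun z hz =>
    summable_of_sum_le (fun j => hG j z hz) fun s => hGf s z hz
  obtain ⟨g, hg⟩ := exists_clm_eq_of_nonneg (p := fun z => ∑' j, G j z) (C := ‖f‖)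
    (fun z hz => tsum_nonneg fun j => hG j z hz)
    (fun a b ha hb => by
      simp only [map_add]
      exact (hs a ha).tsum_add (hs b hb))
    (fun z hz => ((hs z hz).tsum_le_of_sum_le fun s => hGf s z hz).trans
      ((le_abs_self _).trans (f.le_opNorm z)))
  have hg' : ∀ z, 0 ≤ z → HasSum (fun j => G j z) (g z) := fun z hz => by
    rw [hg z hz]; exact (hs z hz).hasSum
  refine ⟨g, fun z => ?_⟩
  have := (hg' _ (posPart_nonneg z)).sub (hg' _ (negPart_nonneg z))
  simpa only [← map_sub, posPart_sub_negPart] using this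

/-- A gliding hump: a weakly null sequence cannot be bounded away from zero on the diagonal of a
sequence of positive functionals with bounded sum and small entries on one side of the diagonal. -/
theorem false_of_gliding_hump {f : E →L[ℝ] ℝ} {F : ℕ → E →L[ℝ] ℝ} {x : ℕ → E} {δ : ℝ}
    (hδ : 0 < δ) (hx : WeakTendsto x atTop 0)
    (hF : ∀ j z, 0 ≤ z → 0 ≤ F j z) (hFf : ∀ (s : Finset ℕ) z, 0 ≤ z → ∑ j ∈ s, F j z ≤ f z)
    (hdiag : ∀ j, 3 * δ ≤ F j (x j)) (hsmall : ∀ i j, i < j → F j |x i| ≤ δ / 2 * (1 / 2) ^ j) :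
    False := by
  have hnull : ∀ g : E →L[ℝ] ℝ, Tendsto (fun n => g (x n)) atTop (𝓝 0) := fun g => by
    simpa using weakTendsto_iff.1 hx g
  obtain ⟨ψ, hψ, hψQ⟩ := exists_strictMono_forall_succ
    (Q := fun N n => ∑ i ∈ Finset.range (N + 1), |F i (x n)| ≤ δ) fun N => by
      have : Tendsto (fun n => ∑ i ∈ Finset.range (N + 1), |F i (x n)|) atTop (𝓝 0) := by
        simpa using tendsto_finsetSum (Finset.range (N + 1)) fun i _ => (hnull (F i)).abs
      exact this.eventually_le_const hδ
  -- The shift makes every earlier index `τ j`, `j < k`, at most `ψ k`, hence covered by `hψQ k`.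
  let τ : ℕ → ℕ := fun k => ψ (k + 1)
  have hτ : StrictMono τ := fun a b hab => hψ (Nat.succ_lt_succ hab)
  obtain ⟨g, hg⟩ := exists_hasSum_clm (f := f) (G := fun j => F (τ j)) (fun j => hF (τ j))
    fun s z hz => by
      rw [← Finset.sum_image (f := fun j => F j z) hτ.injective.injOn]
      exact hFf _ z hz
  have key : ∀ k, δ ≤ g (x (τ k)) := fun k => by
    have h1 : ∑ j ∈ Finset.range k, |F (τ j) (x (τ k))| ≤ δ := by
      refine le_trans ?_ (hψQ k)
      rw [← Finset.sum_image (f := fun j => |F j (x (τ k))|) hτ.injective.injOn]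
      refine Finset.sum_le_sum_of_subset_of_nonneg ?_ fun _ _ _ => abs_nonneg _
      intro i hi
      obtain ⟨j, hj, rfl⟩ := Finset.mem_image.1 hi
      exact Finset.mem_range.2 (Nat.lt_succ_of_le (hψ.monotone (Finset.mem_range.1 hj)))
    -- The series for `g (x (τ k))` is bounded below termwise: `3 * δ` on the diagonal, a loss of at
    -- most `δ` from `j < k` and of `δ` from the geometric tail.
    have s1 : HasSum (fun j => if j = k then 3 * δ else 0) (3 * δ) := hasSum_ite_eq k (3 * δ)
    have s2 : HasSum (fun j => if j < k then |F (τ j) (x (τ k))| else 0)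
        (∑ j ∈ Finset.range k, |F (τ j) (x (τ k))|) := by
      rw [Finset.sum_congr rfl fun j hj => (if_pos (Finset.mem_range.1 hj)).symm]
      exact hasSum_sum_of_ne_finset_zero fun j hj => if_neg fun h => hj (Finset.mem_range.2 h)
    have s3 : HasSum (fun j : ℕ => δ / 2 * (1 / 2 : ℝ) ^ j) (δ / 2 * 2) :=
      hasSum_geometric_two.mul_left _
    have h2 := hasSum_le (fun j => ?_) ((s1.sub s2).sub s3) (hg (x (τ k)))
    · linarith
    have hpos : 0 ≤ δ / 2 * (1 / 2 : ℝ) ^ j := by positivity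
    rcases lt_trichotomy j k with h | rfl | h
    · rw [if_neg h.ne, if_pos h]
      have := neg_abs_le (F (τ j) (x (τ k)))
      linarith
    · rw [if_pos rfl, if_neg (lt_irrefl _)]
      have := hdiag (τ j)
      linarith
    · rw [if_neg h.ne', if_neg h.not_gt]
      have h3 := hsmall _ _ (hτ h)
      have h4 := neg_le_of_abs_le ((abs_map_le_map_abs (hF (τ j)) (x (τ k))).trans h3)
      have h5 : (1 / 2 : ℝ) ^ τ j ≤ (1 / 2) ^ j :=
        pow_le_pow_of_le_one (by norm_num) (by norm_num) (hτ.id_le j)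
      have h6 : δ / 2 * (1 / 2 : ℝ) ^ τ j ≤ δ / 2 * (1 / 2) ^ j := by gcongr
      linarith
  exact absurd (ge_of_tendsto' ((hnull g).comp hτ.tendsto_atTop) key) hδ.not_ge

theorem tendsto_map_posPart_of_uaw [CompleteSpace E] [IsOrderedModule ℝ E] {x : ℕ → E}
    (hx : WeakTendsto x atTop 0) {f : E →L[ℝ] ℝ} (hf : ∀ z, 0 ≤ z → 0 ≤ f z)
    (hux : ∀ u : E, 0 ≤ u → Tendsto (fun n => f (|x n| ⊓ u)) atTop (𝓝 0)) :
    Tendsto (fun n => f (x n)⁺) atTop (𝓝 0) := by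
  by_contra hcon
  obtain ⟨ε, hε, hfreq⟩ : ∃ ε > 0, ∃ᶠ n in atTop, ε ≤ f (x n)⁺ := by
    by_contra! h
    refine hcon (tendsto_order.2 ⟨fun a ha => Eventually.of_forall fun n =>
      ha.trans_le (hf _ (posPart_nonneg _)), fun a ha => ?_⟩)
    simpa using h a ha
  obtain ⟨θ, hθ, hθε⟩ := extraction_of_frequently_atTop hfreq
  obtain ⟨M, hM⟩ := hx.exists_norm_le
  have hM0 : 0 ≤ M := (norm_nonneg _).trans (hM 0)
  obtain ⟨δ, hδ, rfl⟩ : ∃ δ > 0, 5 * δ = ε := ⟨ε / 5, by positivity, by ring⟩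
  -- The added `1` keeps `K` positive even when `f` or `M` is zero.
  have hK : 0 < ‖f‖ * (2 * M) / δ + 1 := by positivity
  have hKM : ‖f‖ * (2 * M) ≤ (‖f‖ * (2 * M) / δ + 1) * δ := by
    rw [add_mul, div_mul_cancel₀ _ hδ.ne']
    linarith
  obtain ⟨φ, hφ, w, hw, hwx, hdisj, hfw, hsmall⟩ := exists_disjoint_pieces hf (x := x ∘ θ)
    (fun n => hM _) hδ hK hKM hθε fun u hu => (hux u hu).comp hθ.tendsto_atTop
  obtain ⟨F, hF, hFf, hdiag, hFs⟩ := exists_disjoint_functionals hf (x := (x ∘ θ) ∘ φ)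
    (fun n => hM _) hK hKM hw hwx hdisj hfw hsmall
  exact false_of_gliding_hump hδ ((hx.comp_strictMono hθ).comp_strictMono hφ) hF hFf hdiag hFs

end BanachLattice

/-! ### The equivalence. -/

theorem theorem2p1 (E : Type*) [NormedAddCommGroup E] [NormedSpace ℝ E] [CompleteSpace E]
    [Lattice E] [IsOrderedAddMonoid E] [IsOrderedModule ℝ E] [HasSolidNorm E] :
    LatticeOpsSeqWeakContinuous E ↔
      ∀ x : ℕ → E, WeakTendsto x atTop 0 → UawTendsto x atTop 0 := by
  refine ⟨fun h x hx u hu => ?_, fun h => latticeOpsSeqWeakContinuous_of_abs fun x hx g hg => ?_⟩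
  · have := h.inf _ _ _ _ (h.abs x 0 hx) (tendsto_const_nhds : WeakTendsto (fun _ => u) atTop u)
    simpa [inf_eq_left.2 hu] using this
  · have hux : ∀ u : E, 0 ≤ u → Tendsto (fun n => g (|x n| ⊓ u)) atTop (𝓝 0) := fun u hu => by
      simpa using weakTendsto_iff.1 (h x hx u hu) g
    have hneg : WeakTendsto (fun n => -x n) atTop 0 := weakTendsto_iff.2 fun f => by
      simpa using (weakTendsto_iff.1 hx f).neg
    have h1 := tendsto_map_posPart_of_uaw hx hg hux
    have h2 := tendsto_map_posPart_of_uaw hneg hg (by simpa using hux)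
    simpa only [posPart_neg, ← map_add, posPart_add_negPart, add_zero] using h1.add h2
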